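/- Let $C\subset\mathbb{R}$ be the standard Cantor set with the metric $d$ inherited from $\mathbb{R}$. There is a homeomorphism $T\colon C\to C$ with the following properties. (1) $T$ is topologically mixing: for any nonempty open sets $U,V\subset C$ there is $N$ such that $T^n(U)\cap V\neq\emptyset$ for all $n\ge N$. (2) $T$ is completely scrambled: any two distinct points $x,y\in C$ are proximal but not asymptotic, that is, $\liminf_{n\to\infty}d(T^n x,T^n y)=0$ and $\limsup_{n\to\infty}d(T^n x,T^n y)>0$. (3) $(C,T)$ is an inverse limit of bidirectional graph covers: there are finite directed graphs $G_n=(V_n,E_n)$, $n\ge 0$, in which every vertex has an incoming and an outgoing edge, and maps $\phi_n\colon V_{n+1}\to V_n$ that send edges to edges and satisfy $\phi_n(v)=\phi_n(v')$ whenever $(u,v),(u,v')\in E_{n+1}$ and $\phi_n(w)=\phi_n(w')$ whenever $(w,u),(w',u)\in E_{n+1}$, together with a homeomorphism $h$ from $V_{\mathcal G}=\{x\in\prod_n V_n:\phi_n(x_{n+1})=x_n\text{ for all }n\}$ (product topology, each $V_n$ discrete) onto $C$ such that, for $x,y\in V_{\mathcal G}$, one has $T(h(x))=h(y)$ if and only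 if $(x_n,y_n)\in E_n$ for all $n$. -/

import Mathlib

/-- `x, y` is a proximal pair of `T`: `liminf d(Tⁿ x, Tⁿ y) = 0`.
The space is compact, so the sequence of distances is bounded. -/
def IsProximalPair {X : Type*} [MetricSpace X] [CompactSpace X] (T : X → X) (x y : X) : Prop :=
  Filter.liminf (fun n : ℕ => dist (T^[n] x) (T^[n] y)) Filter.atTop = 0

/-- `x, y` is an asymptotic pair of `T`: `limsup d(Tⁿ x, Tⁿ y) = 0`. -/
def IsAsymptoticPair {X : Type*} [MetricSpace X] [CompactSpace X] (T : X → X) (x y : X) : Prop :=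
  Filter.limsup (fun n : ℕ => dist (T^[n] x) (T^[n] y)) Filter.atTop = 0

/-- A Li-Yorke pair is a pair that is proximal but not asymptotic. -/
def IsLiYorkePair {X : Type*} [MetricSpace X] [CompactSpace X] (T : X → X) (x y : X) : Prop :=
  IsProximalPair T x y ∧ ¬ IsAsymptoticPair T x y

/-- A set is scrambled if any two distinct points of it are a Li-Yorke pair. -/
def IsScrambledSet {X : Type*} [MetricSpace X] [CompactSpace X] (T : X → X) (D : Set X) : Prop :=
  ∀ x ∈ D, ∀ y ∈ D, x ≠ y → IsLiYorkePair T x y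

/-- A system is completely scrambled if the whole space is a scrambled set. -/
def IsCompletelyScrambled {X : Type*} [MetricSpace X] [CompactSpace X] (T : X → X) : Prop :=
  IsScrambledSet T Set.univ

/-- Topological mixing. -/
def IsTopologicallyMixing {X : Type*} [TopologicalSpace X] (T : X → X) : Prop :=
  ∀ U V : Set X, IsOpen U → IsOpen V → U.Nonempty → V.Nonempty →
    ∃ N : ℕ, ∀ n ≥ N, ((T^[n] '' U) ∩ V).Nonempty

/-- Every vertex has an incoming and an outgoing edge. -/
def IsEdgeSurjective {V : Type*} (G : Digraph V) : Prop :=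
  ∀ v, (∃ u, G.Adj u v) ∧ (∃ w, G.Adj v w)

/-- A bidirectional graph homomorphism. -/
structure IsBidirectionalHom {V W : Type*} (G : Digraph V) (H : Digraph W) (φ : V → W) :
    Prop where
  map_adj : ∀ u v, G.Adj u v → H.Adj (φ u) (φ v)
  forward : ∀ u v v', G.Adj u v → G.Adj u v' → φ v = φ v'
  backward : ∀ u w w', G.Adj w u → G.Adj w' u → φ w = φ w'

/-- A sequence of bd-covers: finite edge-surjective graphs `G 0, G 1, …` with bidirectional
homomorphisms `φ n : G (n + 1) → G n`. -/
structure BDCoverSeq where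
  V : ℕ → Type
  finite : ∀ n, Finite (V n)
  G : ∀ n, Digraph (V n)
  edgeSurjective : ∀ n, IsEdgeSurjective (G n)
  φ : ∀ n, V (n + 1) → V n
  bidirectional : ∀ n, IsBidirectionalHom (G (n + 1)) (G n) (φ n)

/-- Each vertex set is discrete. -/
instance BDCoverSeq.discreteVertices (𝒢 : BDCoverSeq) (n : ℕ) : TopologicalSpace (𝒢.V n) := ⊥

/-- The inverse limit of the vertex sets; as a subtype it carries the topology induced by the
product topology. -/
abbrev BDCoverSeq.Limit (𝒢 : BDCoverSeq) : Type :=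
  {x : ∀ n, 𝒢.V n // ∀ n, 𝒢.φ n (x (n + 1)) = x n}

/-- The relation on the inverse limit induced by the edges; it is the graph of a
homeomorphism of the inverse limit. -/
def BDCoverSeq.LimitRel (𝒢 : BDCoverSeq) (x y : 𝒢.Limit) : Prop :=
  ∀ n, (𝒢.G n).Adj (x.1 n) (y.1 n)

/-- The standard Cantor set in the real line is compact. -/
instance cantorSet.instCompact : CompactSpace cantorSet :=
  isCompact_iff_compactSpace.mp isCompact_cantorSet

/-! The system is the shift on a compact space of configurations of nested blocks on the integer
line. With l = `blockLen n`, a block of level n+1 and index i consists of copies of the block (n, i)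
along two arithmetic progressions of steps l and l+1, a gap of 4l, one closing block (n, i+1), and
an empty end of length at least 10l. The empty configuration is a fixed point. Blocks of level 0 are
called letters.

Proximality: the blocks of minimal index i of a nonempty configuration exhaust the line
(`IsConfig.exists_hasIndex`), so their empty ends reach arbitrarily far to the right. Inside such an
end the other configuration also has a shorter gap, so both orbits come close to the fixed point at
the same time (`HasIndex.exists_common_gap`).

No asymptotic pairs: an asymptotic pair would have eventually equal letters. If the minimal indices
agree, the last letter i or i+1 of a large block is recognized by the long gap after it; this fixes
the position of the block, and common large blocks force equality (`HasIndex.eq_of_eventually_eq`).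
If they differ, the raised index of the closing block yields incompatible gaps
(`HasIndex.not_eventually_eq`).

Mixing: every nonempty open set contains all configurations with a block (n, 0) at a certain place,
and the two progressions realize every large distance between such blocks
(`exists_isBlockDistance`).

Mixing excludes isolated points, so the space is a Cantor set. Property (3) holds for every
homeomorphism of the Cantor set: the graphs record transitions between classes of points whose
finite orbit segments agree in finitely many coordinates. -/

open Set Filter Topology

/-! ### Perfect compact spaces with countably many clopen coordinates -/

section Splitting

variable {X : Type*} (c : ℕ → X → Bool)

/-- The first coordinate that is not constant on `A`. -/
noncomputable def splitIndex (A : Set X) : ℕ :=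
  sInf {k | ∃ y ∈ A, ∃ z ∈ A, c k y ≠ c k z}

/-- The piece containing `x` after `n` successive binary splittings of the space. -/
noncomputable def splitPiece (x : X) : ℕ → Set X
  | 0 => univ
  | n + 1 => {y ∈ splitPiece x n |
      c (splitIndex c (splitPiece x n)) y = c (splitIndex c (splitPiece x n)) x}

/-- The sequence of choices made by `x` in the successive splittings. -/
noncomputable def splitCode (x : X) (n : ℕ) : Bool := c (splitIndex c (splitPiece c x n)) x

theorem self_mem_splitPiece (x : X) (n : ℕ) : x ∈ splitPiece c x n := by
  induction n with
  | zero => trivial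
  | succ n ih => exact ⟨ih, rfl⟩

theorem splitPiece_eq_of_mem {x y : X} {n : ℕ} (h : y ∈ splitPiece c x n) :
    splitPiece c y n = splitPiece c x n := by
  induction n with
  | zero => rfl
  | succ n ih =>
    obtain ⟨h1, h2⟩ := h
    ext z
    simp only [splitPiece, ih h1, h2]

theorem mem_splitPiece_succ_iff {x y : X} {n : ℕ} :
    y ∈ splitPiece c x (n + 1) ↔ y ∈ splitPiece c x n ∧ splitCode c y n = splitCode c x n := by
  constructor
  · rintro ⟨h1, h2⟩
    exact ⟨h1, by simp only [splitCode, splitPiece_eq_of_mem c h1, h2]⟩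
  · rintro ⟨h1, h2⟩
    refine ⟨h1, ?_⟩
    simpa only [splitCode, splitPiece_eq_of_mem c h1] using h2

theorem mem_splitPiece_iff {x y : X} {n : ℕ} :
    y ∈ splitPiece c x n ↔ ∀ m < n, splitCode c y m = splitCode c x m := by
  induction n with
  | zero => simp [splitPiece]
  | succ n ih =>
    rw [mem_splitPiece_succ_iff, ih, Nat.forall_lt_succ_right]

theorem eq_of_lt_splitIndex {c : ℕ → X → Bool} {A : Set X} {k : ℕ} (hk : k < splitIndex c A)
    {y z : X} (hy : y ∈ A) (hz : z ∈ A) : c k y = c k z := by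
  by_contra h
  exact Nat.notMem_of_lt_sInf hk ⟨y, hy, z, hz, h⟩

variable [TopologicalSpace X]

theorem isOpen_splitPiece (hc : ∀ n, Continuous (c n)) (x : X) (n : ℕ) :
    IsOpen (splitPiece c x n) := by
  induction n with
  | zero => exact isOpen_univ
  | succ n ih =>
    exact ih.inter ((isOpen_discrete {c (splitIndex c (splitPiece c x n)) x}).preimage (hc _))

theorem continuous_splitCode (hc : ∀ n, Continuous (c n)) : Continuous (splitCode c) := by
  refine continuous_pi fun n => continuous_iff_continuousAt.2 fun x => ?_
  refine ((hc (splitIndex c (splitPiece c x n))).continuousAt (x := x)).congr ?_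
  filter_upwards [(isOpen_splitPiece c hc x n).mem_nhds (self_mem_splitPiece c x n)] with y hy
  simp only [splitCode, splitPiece_eq_of_mem c hy]

variable {c}

theorem splitIndex_spec (hc : ∀ n, Continuous (c n))
    (sep : ∀ x y, (∀ n, c n x = c n y) → x = y) (perf : ∀ x : X, ¬ IsOpen {x}) (x : X) (n : ℕ) :
    ∃ y ∈ splitPiece c x n, c (splitIndex c (splitPiece c x n)) y ≠
      c (splitIndex c (splitPiece c x n)) x := by
  have hne : {k | ∃ y ∈ splitPiece c x n, ∃ z ∈ splitPiece c x n, c k y ≠ c k z}.Nonempty := by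
    by_contra hcon
    apply perf x
    convert isOpen_splitPiece c hc x n
    ext y
    refine ⟨fun h => h ▸ self_mem_splitPiece c x n, fun h => sep _ _ fun k => ?_⟩
    by_contra hk
    exact hcon ⟨k, y, h, x, self_mem_splitPiece c x n, hk⟩
  obtain ⟨y, hy, z, hz, hyz⟩ := Nat.sInf_mem hne
  change c (splitIndex c (splitPiece c x n)) y ≠ c (splitIndex c (splitPiece c x n)) z at hyz
  by_cases h : c (splitIndex c (splitPiece c x n)) y = c (splitIndex c (splitPiece c x n)) x
  · exact ⟨z, hz, fun h' => hyz (h.trans h'.symm)⟩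
  · exact ⟨y, hy, h⟩

/-- The coordinate used for a splitting is constant on the resulting pieces, as are all smaller
ones, so the splitting index strictly increases. Hence the code of a point determines all its
coordinates. -/
theorem le_splitIndex (hc : ∀ n, Continuous (c n))
    (sep : ∀ x y, (∀ n, c n x = c n y) → x = y) (perf : ∀ x : X, ¬ IsOpen {x}) (x : X) (n : ℕ) :
    n ≤ splitIndex c (splitPiece c x n) := by
  induction n with
  | zero => exact Nat.zero_le _
  | succ n ih =>
    obtain ⟨y, hy, hne⟩ := splitIndex_spec hc sep perf x (n + 1)
    refine Nat.succ_le_of_lt (ih.trans_lt (lt_of_not_ge fun hle => hne ?_))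
    rcases hle.lt_or_eq with h | h
    · exact eq_of_lt_splitIndex h hy.1 (self_mem_splitPiece c x n)
    · rw [h]
      exact hy.2

theorem splitCode_injective (hc : ∀ n, Continuous (c n))
    (sep : ∀ x y, (∀ n, c n x = c n y) → x = y) (perf : ∀ x : X, ¬ IsOpen {x}) :
    Function.Injective (splitCode c) := by
  intro x y hxy
  refine sep x y fun k => ?_
  have hmem : x ∈ splitPiece c y (k + 1) :=
    (mem_splitPiece_iff c).2 fun m _ => congrFun hxy m
  exact eq_of_lt_splitIndex (le_splitIndex hc sep perf y (k + 1)) hmem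
    (self_mem_splitPiece c y (k + 1))

theorem splitCode_surjective [CompactSpace X] [Nonempty X] (hc : ∀ n, Continuous (c n))
    (sep : ∀ x y, (∀ n, c n x = c n y) → x = y) (perf : ∀ x : X, ¬ IsOpen {x}) :
    Function.Surjective (splitCode c) := by
  intro b
  let S : ℕ → Set X := fun n => {x | ∀ m < n, splitCode c x m = b m}
  have hclosed : ∀ n, IsClosed (S n) := fun n => by
    simp only [S, ofPred_forall]
    exact isClosed_iInter fun m => isClosed_iInter fun _ =>
      isClosed_eq ((continuous_apply m).comp (continuous_splitCode c hc)) continuous_const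
  have hne : ∀ n, (S n).Nonempty := by
    intro n
    induction n with
    | zero => exact ⟨Classical.arbitrary X, fun m hm => absurd hm (Nat.not_lt_zero m)⟩
    | succ n ih =>
      obtain ⟨x, hx⟩ := ih
      by_cases h : splitCode c x n = b n
      · exact ⟨x, (Nat.forall_lt_succ_right).2 ⟨hx, h⟩⟩
      · obtain ⟨y, hy, hyx⟩ := splitIndex_spec hc sep perf x n
        refine ⟨y, (Nat.forall_lt_succ_right).2 ⟨fun m hm => ?_, ?_⟩⟩
        · rw [(mem_splitPiece_iff c).1 hy m hm, hx m hm]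
        · have h2 : splitCode c y n ≠ splitCode c x n := by
            simpa only [splitCode, splitPiece_eq_of_mem c hy] using hyx
          revert h h2
          cases splitCode c y n <;> cases splitCode c x n <;> cases b n <;> simp
  obtain ⟨x, hx⟩ := IsCompact.nonempty_iInter_of_sequence_nonempty_isCompact_isClosed S
    (fun n x hx m hm => hx m (hm.trans n.lt_succ_self)) hne (hclosed 0).isCompact hclosed
  rw [mem_iInter] at hx
  exact ⟨x, funext fun m => hx (m + 1) m m.lt_succ_self⟩

/-- A nonempty compact space without isolated points whose points are separated by countably many
continuous maps to `Bool` is homeomorphic to the Cantor space. -/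
theorem nonempty_homeomorph_nat_to_bool [CompactSpace X] [Nonempty X]
    (hc : ∀ n, Continuous (c n)) (sep : ∀ x y, (∀ n, c n x = c n y) → x = y)
    (perf : ∀ x : X, ¬ IsOpen {x}) : Nonempty (X ≃ₜ (ℕ → Bool)) :=
  ⟨(continuous_splitCode c hc).homeoOfEquivCompactToT2
    (f := Equiv.ofBijective _ ⟨splitCode_injective hc sep perf, splitCode_surjective hc sep perf⟩)⟩

end Splitting

/-! ### Homeomorphisms as inverse limits of bidirectional graph covers -/

section BDCover

variable {C : Type} [TopologicalSpace C] (T : C ≃ₜ C) (e : C → ℕ → Bool)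

/-- Points are identified at level `n` if their orbits from time `-n` to `n` agree in finitely many
coordinates. -/
def orbitSetoid : ℕ → Setoid C
  | 0 => ⊤
  | n + 1 =>
    { r := fun x y => orbitSetoid n x y ∧ orbitSetoid n (T x) (T y) ∧
        orbitSetoid n (T.symm x) (T.symm y) ∧ e x n = e y n
      iseqv :=
        { refl := fun _ => ⟨(orbitSetoid n).refl _, (orbitSetoid n).refl _,
            (orbitSetoid n).refl _, rfl⟩
          symm := fun h => ⟨(orbitSetoid n).symm h.1, (orbitSetoid n).symm h.2.1,
            (orbitSetoid n).symm h.2.2.1, h.2.2.2.symm⟩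
          trans := fun h k => ⟨(orbitSetoid n).trans h.1 k.1,
            (orbitSetoid n).trans h.2.1 k.2.1, (orbitSetoid n).trans h.2.2.1 k.2.2.1,
            h.2.2.2.trans k.2.2.2⟩ } }

variable {T e}

theorem orbitSetoid_rel_map {n : ℕ} {x y : C} (h : orbitSetoid T e (n + 1) x y) :
    orbitSetoid T e n (T x) (T y) := h.2.1

theorem orbitSetoid_rel_symm_map {n : ℕ} {x y : C} (h : orbitSetoid T e (n + 1) x y) :
    orbitSetoid T e n (T.symm x) (T.symm y) := h.2.2.1

theorem orbitSetoid_rel_of_succ {n : ℕ} {x y : C} (h : orbitSetoid T e (n + 1) x y) :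
    orbitSetoid T e n x y := h.1

theorem eq_of_forall_orbitSetoid (he : Function.Injective e) {x y : C}
    (h : ∀ n, orbitSetoid T e n x y) : x = y :=
  he (funext fun n => (h (n + 1)).2.2.2)

variable (T e)

theorem finite_quotient_orbitSetoid (n : ℕ) : Finite (Quotient (orbitSetoid T e n)) := by
  induction n with
  | zero =>
    have : Subsingleton (Quotient (orbitSetoid T e 0)) :=
      ⟨fun a b => Quotient.inductionOn₂ a b fun _ _ => Quotient.sound trivial⟩
    exact Finite.of_subsingleton
  | succ n ih =>
    let q : C → Quotient (orbitSetoid T e n) := Quotient.mk _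
    let F : Quotient (orbitSetoid T e (n + 1)) → _ :=
      Quotient.lift (fun x => (q x, q (T x), q (T.symm x), e x n)) (by
        intro x y h
        have h1 : q x = q y := Quotient.sound h.1
        have h2 : q (T x) = q (T y) := Quotient.sound h.2.1
        have h3 : q (T.symm x) = q (T.symm y) := Quotient.sound h.2.2.1
        have h4 : e x n = e y n := h.2.2.2
        simp only [h1, h2, h3, h4])
    refine Finite.of_injective F fun a b => Quotient.inductionOn₂ a b fun x y h => ?_
    simp only [F, Quotient.lift_mk, Prod.mk.injEq] at h
    exact Quotient.sound ⟨Quotient.exact h.1, Quotient.exact h.2.1, Quotient.exact h.2.2.1,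
      h.2.2.2⟩

variable {e} in
theorem isOpen_orbitSetoid_class (he : Continuous e) (n : ℕ) (x : C) :
    IsOpen {y | orbitSetoid T e n y x} := by
  induction n generalizing x with
  | zero => exact isOpen_univ
  | succ n ih =>
    exact (ih x).inter (((ih (T x)).preimage T.continuous).inter
      (((ih (T.symm x)).preimage T.symm.continuous).inter
        ((isOpen_discrete {e x n}).preimage ((continuous_apply n).comp he))))

/-- The graphs of the transitions between orbit classes. -/
def orbitCover : BDCoverSeq where
  V n := Quotient (orbitSetoid T e n)
  finite := finite_quotient_orbitSetoid T e
  G n := ⟨fun u v => ∃ x, Quotient.mk _ x = u ∧ Quotient.mk _ (T x) = v⟩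
  edgeSurjective n v := by
    induction v using Quotient.inductionOn with
    | _ x => exact ⟨⟨_, T.symm x, rfl, by rw [T.apply_symm_apply]⟩, ⟨_, x, rfl, rfl⟩⟩
  φ n := Quotient.map id fun _ _ h => orbitSetoid_rel_of_succ h
  bidirectional n :=
    { map_adj := by
        rintro _ _ ⟨x, rfl, rfl⟩
        exact ⟨x, rfl, rfl⟩
      -- A class of level n+1 determines the classes of level n of the image and the preimage; the
      -- setoid refines in both time directions for this purpose.
      forward := by
        rintro _ _ _ ⟨x, rfl, rfl⟩ ⟨y, hy, rfl⟩
        exact Quotient.sound (orbitSetoid_rel_map (Quotient.exact hy.symm))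
      backward := by
        rintro _ _ _ ⟨x, rfl, rfl⟩ ⟨y, rfl, hy⟩
        have h := orbitSetoid_rel_symm_map (Quotient.exact hy.symm)
        rw [T.symm_apply_apply, T.symm_apply_apply] at h
        exact Quotient.sound h }

instance BDCoverSeq.discreteTopology (𝒢 : BDCoverSeq) (n : ℕ) : DiscreteTopology (𝒢.V n) := ⟨rfl⟩

/-- A point, as a sequence of orbit classes. -/
def orbitCoverPoint (x : C) : (orbitCover T e).Limit :=
  ⟨fun _ => Quotient.mk _ x, fun _ => rfl⟩

variable {e}

theorem continuous_orbitCoverPoint (he : Continuous e) : Continuous (orbitCoverPoint T e) := by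
  refine Continuous.subtype_mk (continuous_pi fun n => ?_) _
  refine (IsLocallyConstant.iff_exists_open _).2 (fun x => ?_) |>.continuous
  exact ⟨_, isOpen_orbitSetoid_class T he n x, (orbitSetoid T e n).refl x,
    fun y hy => Quotient.sound hy⟩

theorem orbitCoverPoint_injective (he : Function.Injective e) :
    Function.Injective (orbitCoverPoint T e) := fun _ _ h =>
  eq_of_forall_orbitSetoid (T := T) he fun n =>
    Quotient.exact (congrFun (congrArg Subtype.val h) n)

theorem orbitCoverPoint_surjective [CompactSpace C] (he : Continuous e) :
    Function.Surjective (orbitCoverPoint T e) := by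
  intro v
  let S : ℕ → Set C := fun n => {x | (orbitCoverPoint T e x).1 n = v.1 n}
  have hclosed : ∀ n, IsClosed (S n) := fun n => isClosed_eq
    ((continuous_apply n).comp (continuous_subtype_val.comp (continuous_orbitCoverPoint T he)))
    continuous_const
  have hne : ∀ n, (S n).Nonempty := fun n => Quotient.exists_rep (v.1 n)
  obtain ⟨x, hx⟩ := IsCompact.nonempty_iInter_of_sequence_nonempty_isCompact_isClosed S
    (fun n x hx => by
      have h := congrArg ((orbitCover T e).φ n) hx
      rw [v.2 n] at h
      exact h) hne (hclosed 0).isCompact hclosed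
  rw [mem_iInter] at hx
  exact ⟨x, Subtype.ext (funext hx)⟩

/-- A homeomorphism of a compact zero-dimensional space with countably many clopen coordinates is
an inverse limit of bidirectional graph covers. -/
theorem exists_bdCoverSeq_homeomorph [CompactSpace C] (he : Continuous e)
    (hinj : Function.Injective e) :
    ∃ (𝒢 : BDCoverSeq) (h : 𝒢.Limit ≃ₜ C),
      ∀ x y : 𝒢.Limit, 𝒢.LimitRel x y ↔ T (h x) = h y := by
  let f : C ≃ₜ (orbitCover T e).Limit := (continuous_orbitCoverPoint T he).homeoOfEquivCompactToT2
    (f := Equiv.ofBijective _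
      ⟨orbitCoverPoint_injective T hinj, orbitCoverPoint_surjective T he⟩)
  refine ⟨orbitCover T e, f.symm, fun x y => ?_⟩
  obtain ⟨x, rfl⟩ := f.surjective x
  obtain ⟨y, rfl⟩ := f.surjective y
  rw [f.symm_apply_apply, f.symm_apply_apply]
  constructor
  · refine fun h => eq_of_forall_orbitSetoid (T := T) hinj fun n => ?_
    obtain ⟨z, hz1, hz2⟩ := h (n + 1)
    have h1 : orbitSetoid T e (n + 1) z x := Quotient.exact hz1
    have h2 : orbitSetoid T e (n + 1) (T z) y := Quotient.exact hz2
    exact (orbitSetoid T e n).trans ((orbitSetoid T e n).symm (orbitSetoid_rel_map h1))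
      (orbitSetoid_rel_of_succ h2)
  · rintro rfl n
    exact ⟨x, rfl, rfl⟩

end BDCover

/-! ### Block lengths and positions -/

/-- The length of the blocks of level `n`. -/
def blockLen : ℕ → ℤ
  | 0 => 8
  -- The progressions span about 31l² and l²; the linear term holds the gaps, the closing block and
  -- the empty end.
  | n + 1 => 32 * blockLen n ^ 2 + 20 * blockLen n

/-- The additional distance between the two arithmetic progressions of copies. -/
def stretch (n : ℕ) : ℤ := blockLen n / 8

/-- The position of the last copy of a block of level `n` in its successor. -/
def lastCopy (n : ℕ) : ℤ :=
  1 + (31 * blockLen n + 1) * blockLen n + stretch n + blockLen n * (blockLen n + 1)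

/-- The positions of the copies of a block of level `n` in its successor. -/
noncomputable def copies (n : ℕ) : Finset ℤ :=
  (Finset.Icc 0 (31 * blockLen n)).image (fun j => 1 + j * blockLen n) ∪
    (Finset.Icc 0 (blockLen n)).image
      (fun j => 1 + (31 * blockLen n + 1) * blockLen n + stretch n + j * (blockLen n + 1))

/-- The position of the closing block of level `n`, whose index is raised by one. -/
def tailPos (n : ℕ) : ℤ := lastCopy n + 5 * blockLen n

theorem eight_le_blockLen (n : ℕ) : 8 ≤ blockLen n := by
  induction n with
  | zero => simp [blockLen]
  | succ n ih => simp only [blockLen]; nlinarith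

theorem blockLen_pos (n : ℕ) : 0 < blockLen n := by linarith [eight_le_blockLen n]

theorem eight_mul_stretch (n : ℕ) : 8 * stretch n = blockLen n := by
  have h : 8 ∣ blockLen n := by
    induction n with
    | zero => simp [blockLen]
    | succ n ih =>
      obtain ⟨a, ha⟩ := ih
      exact ⟨a * (256 * a + 20), by simp only [blockLen, ha]; ring⟩
  exact Int.mul_ediv_cancel' h

theorem one_le_stretch (n : ℕ) : 1 ≤ stretch n := by
  linarith [eight_mul_stretch n, eight_le_blockLen n]

theorem blockLen_succ (n : ℕ) : blockLen (n + 1) = 32 * blockLen n ^ 2 + 20 * blockLen n := rfl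

theorem lastCopy_eq (n : ℕ) :
    lastCopy n = 32 * blockLen n ^ 2 + 2 * blockLen n + stretch n + 1 := by
  rw [lastCopy]; ring

theorem tailPos_eq (n : ℕ) : tailPos n = lastCopy n + 5 * blockLen n := rfl

theorem tailPos_add_le (n : ℕ) : tailPos n + 11 * blockLen n ≤ blockLen (n + 1) := by
  rw [tailPos_eq, lastCopy_eq, blockLen_succ]
  linarith [eight_mul_stretch n, eight_le_blockLen n]

theorem lastCopy_pos (n : ℕ) : 0 < lastCopy n := by
  rw [lastCopy_eq]
  have := blockLen_pos n
  have := one_le_stretch n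
  positivity

theorem mem_copies {n : ℕ} {p : ℤ} : p ∈ copies n ↔
    (∃ j, 0 ≤ j ∧ j ≤ 31 * blockLen n ∧ p = 1 + j * blockLen n) ∨
    (∃ j, 0 ≤ j ∧ j ≤ blockLen n ∧
      p = 1 + (31 * blockLen n + 1) * blockLen n + stretch n + j * (blockLen n + 1)) := by
  simp only [copies, Finset.mem_union, Finset.mem_image, Finset.mem_Icc, and_assoc, eq_comm]

theorem one_mem_copies (n : ℕ) : 1 ∈ copies n :=
  mem_copies.2 (.inl ⟨0, le_rfl, by linarith [blockLen_pos n], by ring⟩)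

theorem lastCopy_mem_copies (n : ℕ) : lastCopy n ∈ copies n :=
  mem_copies.2 (.inr ⟨_, (blockLen_pos n).le, le_rfl, rfl⟩)

theorem one_le_of_mem_copies {n : ℕ} {p : ℤ} (h : p ∈ copies n) : 1 ≤ p := by
  have := blockLen_pos n
  have := one_le_stretch n
  rcases mem_copies.1 h with ⟨j, h0, -, rfl⟩ | ⟨j, h0, -, rfl⟩
  · nlinarith
  · nlinarith [mul_nonneg h0 (by linarith : 0 ≤ blockLen n + 1)]

theorem copies_apart {n : ℕ} {p q : ℤ} (hp : p ∈ copies n) (hq : q ∈ copies n) (h : p < q) :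
    p + blockLen n ≤ q := by
  have h1 := blockLen_pos n
  have h2 := one_le_stretch n
  rcases mem_copies.1 hp with ⟨j, h0, hj, rfl⟩ | ⟨j, h0, hj, rfl⟩ <;>
    rcases mem_copies.1 hq with ⟨i, h0', hi, rfl⟩ | ⟨i, h0', hi, rfl⟩
  · have : j < i := by
      by_contra hc
      push Not at hc
      nlinarith
    nlinarith
  · nlinarith [mul_nonneg h0' (by linarith : 0 ≤ blockLen n + 1)]
  · exfalso
    nlinarith [mul_nonneg h0 (by linarith : 0 ≤ blockLen n + 1)]
  · have : j < i := by
      by_contra hc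
      push Not at hc
      nlinarith
    nlinarith

/-- The widest step, `blockLen n + stretch n`, occurs between the two progressions. It stays well
below the step of 5l to the closing block, so that the latter is recognizable. -/
theorem exists_next_copy {n : ℕ} {p : ℤ} (hp : p ∈ copies n) (h : p ≠ lastCopy n) :
    ∃ q ∈ copies n, p + blockLen n ≤ q ∧ q ≤ p + 2 * blockLen n := by
  have h1 := eight_le_blockLen n
  have h2 := one_le_stretch n
  have h3 := eight_mul_stretch n
  rcases mem_copies.1 hp with ⟨j, h0, hj, rfl⟩ | ⟨j, h0, hj, rfl⟩
  · rcases hj.lt_or_eq with hj | rfl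
    · exact ⟨1 + (j + 1) * blockLen n,
        mem_copies.2 (.inl ⟨j + 1, by linarith, by linarith, rfl⟩), by linarith, by linarith⟩
    · exact ⟨_, mem_copies.2 (.inr ⟨0, le_rfl, by linarith, rfl⟩), by linarith, by linarith⟩
  · rcases hj.lt_or_eq with hj | rfl
    · exact ⟨_, mem_copies.2 (.inr ⟨j + 1, by linarith, by linarith, rfl⟩), by linarith,
        by linarith⟩
    · exact absurd rfl h

theorem le_lastCopy {n : ℕ} {p : ℤ} (hp : p ∈ copies n) : p ≤ lastCopy n := by
  by_contra h
  push Not at h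
  have h1 := copies_apart (lastCopy_mem_copies n) hp h
  have h2 := one_le_stretch n
  have h3 := eight_mul_stretch n
  have h4 := eight_le_blockLen n
  rw [lastCopy_eq] at h1
  rcases mem_copies.1 hp with ⟨j, h0, hj, rfl⟩ | ⟨j, h0, hj, rfl⟩
  · nlinarith
  · nlinarith

theorem blockLen_strictMono : StrictMono blockLen := strictMono_nat_of_lt_succ fun n => by
  linarith [tailPos_add_le n, tailPos_eq n, lastCopy_pos n, blockLen_pos n]

theorem lt_blockLen (n : ℕ) : (n : ℤ) < blockLen n := by
  induction n with
  | zero => simp [blockLen]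
  | succ n ih =>
    have := blockLen_strictMono n.lt_succ_self
    push_cast
    linarith

/-! ### Configurations of nested blocks -/

/-- A configuration records the positions `s` at which a block of level `n` and index `i` starts.
The blocks of level `n` are the constituents of the blocks of level `n + 1`, and blocks of the same
level do not overlap. -/
structure IsConfig (x : ℕ × ℕ × ℤ → Bool) : Prop where
  mem_iff : ∀ n i s, x (n, i, s) ↔ (∃ p ∈ copies n, x (n + 1, i, s - p)) ∨
    ∃ i', i = i' + 1 ∧ x (n + 1, i', s - tailPos n)
  apart : ∀ n i s i' s', x (n, i, s) → x (n, i', s') →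
    (i = i' ∧ s = s') ∨ s + blockLen n ≤ s' ∨ s' + blockLen n ≤ s

namespace IsConfig

variable {x y : ℕ × ℕ × ℤ → Bool} {m n i j : ℕ} {s p q : ℤ}

theorem copy (hx : IsConfig x) (h : x (n + 1, i, s)) (hp : p ∈ copies n) : x (n, i, s + p) :=
  (hx.mem_iff _ _ _).2 (.inl ⟨p, hp, by rwa [add_sub_cancel_right]⟩)

theorem tail (hx : IsConfig x) (h : x (n + 1, i, s)) : x (n, i + 1, s + tailPos n) :=
  (hx.mem_iff _ _ _).2 (.inr ⟨i, rfl, by rwa [add_sub_cancel_right]⟩)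

theorem eq_of_overlap (hx : IsConfig x) {i' : ℕ} {s' : ℤ} (h : x (n, i, s)) (h' : x (n, i', s'))
    (hq : s ≤ q) (hq1 : q < s + blockLen n) (hq' : s' ≤ q) (hq1' : q < s' + blockLen n) :
    i = i' ∧ s = s' := by
  rcases hx.apart n i s i' s' h h' with h | h | h
  · exact h
  · linarith
  · linarith

/-- Every block is a copy in, or the closing block of, a block of the next level. -/
theorem exists_parent (hx : IsConfig x) (h : x (n, i, s)) :
    (∃ s', x (n + 1, i, s') ∧ ∃ p ∈ copies n, s = s' + p) ∨
      ∃ i' s', i = i' + 1 ∧ x (n + 1, i', s') ∧ s = s' + tailPos n := by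
  rcases (hx.mem_iff n i s).1 h with ⟨p, hp, h⟩ | ⟨i', hi, h⟩
  · exact .inl ⟨_, h, p, hp, by ring⟩
  · exact .inr ⟨i', _, hi, h, by ring⟩

/-- Passing to parents never raises the index. Offsets are at least 1, so ancestors also grow to the
left. -/
theorem exists_parent_covering (hx : IsConfig x) (h : x (n, i, s)) :
    ∃ i' ≤ i, ∃ s', x (n + 1, i', s') ∧ s' + 1 ≤ s ∧ s ≤ s' + tailPos n := by
  have h1 := tailPos_eq n
  have h2 := blockLen_pos n
  have h3 := lastCopy_pos n
  rcases hx.exists_parent h with ⟨s', h', p, hp, rfl⟩ | ⟨i', s', rfl, h', rfl⟩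
  · exact ⟨i, le_rfl, s', h', by linarith [one_le_of_mem_copies hp], by linarith [le_lastCopy hp]⟩
  · exact ⟨i', Nat.le_succ _, s', h', by linarith, le_rfl⟩

theorem exists_ancestor (hx : IsConfig x) (h : x (m, j, q)) (hmn : m ≤ n) :
    ∃ i ≤ j, ∃ s, x (n, i, s) ∧ s ≤ q ∧ q < s + blockLen n := by
  induction n, hmn using Nat.le_induction with
  | base => exact ⟨j, le_rfl, q, h, le_rfl, by linarith [blockLen_pos m]⟩
  | succ n _ ih =>
    obtain ⟨i, hi, s, hs, h1, h2⟩ := ih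
    obtain ⟨i', hi', s', hs', h1', h2'⟩ := hx.exists_parent_covering hs
    exact ⟨i', hi'.trans hi, s', hs', by linarith,
      by linarith [tailPos_add_le n, blockLen_pos n]⟩

/-- Everything below level `n` inside a block of level `n + 1` lies inside one of its
constituents. -/
theorem mem_constituent (hx : IsConfig x) (h : x (n + 1, i, s)) (hq : x (m, j, q)) (hmn : m ≤ n)
    (h1 : s ≤ q) (h2 : q < s + blockLen (n + 1)) :
    (∃ p ∈ copies n, x (n, i, s + p) ∧ s + p ≤ q ∧ q < s + p + blockLen n) ∨
      (x (n, i + 1, s + tailPos n) ∧ s + tailPos n ≤ q ∧ q < s + tailPos n + blockLen n) := by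
  obtain ⟨i1, -, r, hr, hr1, hr2⟩ := hx.exists_ancestor hq hmn
  have h3 := tailPos_add_le n
  have h4 := tailPos_eq n
  have h5 := blockLen_pos n
  have h6 := lastCopy_pos n
  rcases hx.exists_parent hr with ⟨s', h', p, hp, rfl⟩ | ⟨i', s', rfl, h', rfl⟩
  · have h7 := one_le_of_mem_copies hp
    have h8 := le_lastCopy hp
    obtain ⟨rfl, rfl⟩ := hx.eq_of_overlap h' h (q := q) (by linarith) (by linarith) h1 h2
    exact .inl ⟨p, hp, hr, hr1, hr2⟩
  · obtain ⟨rfl, rfl⟩ := hx.eq_of_overlap h' h (q := q) (by linarith) (by linarith) h1 h2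
    exact .inr ⟨hr, hr1, hr2⟩

/-- Blocks of the same level and index have the same content. -/
theorem same_content (hx : IsConfig x) (hy : IsConfig y) (hmn : m ≤ n) {s s' : ℤ}
    (h : x (n, i, s)) (h' : y (n, i, s')) (h1 : s ≤ q) (h2 : q < s + blockLen n)
    (hq : x (m, j, q)) : y (m, j, q - s + s') := by
  induction n, hmn using Nat.le_induction generalizing i s s' with
  | base =>
    obtain ⟨rfl, rfl⟩ := hx.eq_of_overlap h hq h1 h2 le_rfl (by linarith [blockLen_pos m])
    rwa [sub_self, zero_add]
  | succ n hmn ih =>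
    rcases hx.mem_constituent h hq hmn h1 h2 with ⟨p, hp, hr, hr1, hr2⟩ | ⟨hr, hr1, hr2⟩
    · convert ih hr (hy.copy h' hp) hr1 hr2 using 4
      ring
    · convert ih hr (hy.tail h') hr1 hr2 using 4
      ring

theorem exists_letter (hx : IsConfig x) (h : x (n, i, s)) :
    ∃ q, s ≤ q ∧ q < s + blockLen n ∧ x (0, i, q) := by
  induction n generalizing s with
  | zero => exact ⟨s, le_rfl, by linarith [blockLen_pos 0], h⟩
  | succ n ih =>
    obtain ⟨q, h1, h2, h3⟩ := ih (hx.copy h (one_mem_copies n))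
    exact ⟨q, by linarith, by
      linarith [tailPos_add_le n, tailPos_eq n, lastCopy_pos n, blockLen_pos n], h3⟩

end IsConfig

namespace IsConfig

variable {x y : ℕ × ℕ × ℤ → Bool} {m n i j : ℕ} {s p q : ℤ}

theorem index_le (hx : IsConfig x) (h : x (n, i, s)) (hq : x (m, j, q)) (hmn : m ≤ n)
    (h1 : s ≤ q) (h2 : q < s + blockLen n) : i ≤ j := by
  obtain ⟨i1, hi1, r, hr, hr1, hr2⟩ := hx.exists_ancestor hq hmn
  obtain ⟨rfl, -⟩ := hx.eq_of_overlap h hr h1 h2 hr1 hr2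
  exact hi1

/-- The end of a block of level `n + 1` is empty below level `n + 1`. -/
theorem lt_of_mem_block (hx : IsConfig x) (h : x (n + 1, i, s)) (hq : x (m, j, q)) (hmn : m ≤ n)
    (h1 : s ≤ q) (h2 : q < s + blockLen (n + 1)) : q < s + tailPos n + blockLen n := by
  rcases hx.mem_constituent h hq hmn h1 h2 with ⟨p, hp, -, -, h3⟩ | ⟨-, -, h3⟩
  · linarith [le_lastCopy hp, tailPos_eq n, blockLen_pos n]
  · exact h3

theorem eq_of_common_blocks (hx : IsConfig x) (hy : IsConfig y)
    (h : ∀ N : ℕ, ∃ n ≥ N, ∃ i s, x (n, i, s) ∧ y (n, i, s) ∧ s ≤ -N ∧ N < s + blockLen n) :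
    x = y := by
  funext ⟨m, j, q⟩
  obtain ⟨n, hn, i, s, h1, h2, h3, h4⟩ := h (m + q.natAbs)
  rw [Nat.cast_add] at h3 h4
  have h5 : s ≤ q := by omega
  have h6 : q < s + blockLen n := by omega
  rw [Bool.eq_iff_iff]
  constructor
  · intro hq
    have := hx.same_content hy (by omega) h1 h2 h5 h6 hq
    rwa [sub_add_cancel] at this
  · intro hq
    have := hy.same_content hx (by omega) h2 h1 h5 h6 hq
    rwa [sub_add_cancel] at this

end IsConfig

/-- The configuration `x` has minimal index `i`, and its blocks of index `i` exhaust the line. -/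
structure HasIndex (x : ℕ × ℕ × ℤ → Bool) (i : ℕ) : Prop where
  le : ∀ n j s, x (n, j, s) → i ≤ j
  exhaust : ∀ R : ℤ, ∃ n₁, ∀ n ≥ n₁, ∃ s, x (n, i, s) ∧ s ≤ -R ∧ R < s + blockLen n

/-! ### Minimal indices and pairs of configurations -/

section

variable {x y : ℕ × ℕ × ℤ → Bool} {n i j : ℕ} {s : ℤ}

theorem IsConfig.exists_hasIndex (hx : IsConfig x) (h : ∃ c, x c) : ∃ i, HasIndex x i := by
  classical
  obtain ⟨⟨n, i, s⟩, hc⟩ := h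
  have hex : ∃ i n s, x (n, i, s) := ⟨i, n, s, hc⟩
  obtain ⟨n₀, q, hq⟩ := Nat.find_spec hex
  have hmin : ∀ n j s, x (n, j, s) → Nat.find hex ≤ j :=
    fun n j s h => Nat.find_min' hex ⟨n, s, h⟩
  generalize Nat.find hex = i at hq hmin
  -- By minimality all ancestors keep the index i, and each parent extends its child by at least one
  -- unit on both sides.
  have key : ∀ k : ℕ, ∃ s, x (n₀ + k, i, s) ∧ s ≤ q - k ∧ q + k < s + blockLen (n₀ + k) := by
    intro k
    induction k with
    | zero => exact ⟨q, hq, by simp, by simpa using blockLen_pos n₀⟩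
    | succ k ih =>
      obtain ⟨s, h1, h2, h3⟩ := ih
      obtain ⟨i', hi', s', h1', h2', h3'⟩ := hx.exists_parent_covering h1
      obtain rfl : i' = i := le_antisymm hi' (hmin _ _ _ h1')
      refine ⟨s', h1', by push_cast; linarith, ?_⟩
      have := tailPos_add_le (n₀ + k)
      have := blockLen_pos (n₀ + k)
      push_cast
      rw [← add_assoc n₀]
      linarith
  refine ⟨i, hmin, fun R => ⟨n₀ + (q.natAbs + R.natAbs), fun n hn => ?_⟩⟩
  obtain ⟨k, rfl⟩ := Nat.exists_eq_add_of_le (show n₀ ≤ n by omega)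
  obtain ⟨s, h1, h2, h3⟩ := key k
  exact ⟨s, h1, by omega, by omega⟩

/-- Consecutive blocks of minimal index that cover the origin are nested as copies. -/
theorem HasIndex.exists_copy (hi : HasIndex x i) (hx : IsConfig x) {s' : ℤ} (h : x (n, i, s))
    (h0 : s ≤ 0) (h1 : 0 < s + blockLen n) (h' : x (n + 1, i, s')) (h0' : s' ≤ 0)
    (h1' : 0 < s' + blockLen (n + 1)) : ∃ p ∈ copies n, s = s' + p := by
  rcases hx.exists_parent h with ⟨r, hr, p, hp, rfl⟩ | ⟨i', r, rfl, hr, -⟩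
  · refine ⟨p, hp, ?_⟩
    have h2 := one_le_of_mem_copies hp
    have h3 := le_lastCopy hp
    have h4 := tailPos_add_le n
    have h5 := tailPos_eq n
    have h6 := blockLen_pos n
    obtain ⟨-, rfl⟩ := hx.eq_of_overlap hr h' (q := 0) (by linarith) (by linarith) h0' h1'
    rfl
  · exact absurd (hi.le _ _ _ hr) (by omega)

/-- Blocks of minimal index whose closing block lies far to the right. -/
theorem HasIndex.exists_tail_gt (hi : HasIndex x i) (hx : IsConfig x) (R : ℤ) :
    ∃ n₁, ∀ n ≥ n₁, ∃ s, x (n + 1, i, s) ∧ s ≤ -R ∧ R < s + tailPos n := by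
  obtain ⟨n₁, hn₁⟩ := hi.exhaust (max R 0)
  refine ⟨n₁, fun n hn => ?_⟩
  obtain ⟨s, h1, h2, h3⟩ := hn₁ n hn
  obtain ⟨s', h1', h2', h3'⟩ := hn₁ (n + 1) (by omega)
  have h4 := le_max_left R 0
  have h5 := le_max_right R 0
  obtain ⟨p, hp, rfl⟩ := hi.exists_copy hx h1 (by linarith) (by linarith) h1' (by linarith)
    (by linarith)
  exact ⟨s', h1', by linarith, by linarith [le_lastCopy hp, tailPos_eq n, blockLen_pos n]⟩

theorem HasIndex.exists_letter_ge (hi : HasIndex x i) (hx : IsConfig x) (t₀ : ℤ) :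
    ∃ t ≥ t₀, x (0, i + 1, t) := by
  obtain ⟨n, hn⟩ := hi.exists_tail_gt hx t₀
  obtain ⟨s, h1, -, h2⟩ := hn n le_rfl
  obtain ⟨q, h3, -, h4⟩ := hx.exists_letter (hx.tail h1)
  exact ⟨q, by linarith, h4⟩

/-- In a block of level `n + 1` and index `i`, all gaps between the letters `i` and `i + 1` are
short, and the gap following the last of them is long. -/
theorem IsConfig.exists_last_letter (hx : IsConfig x) (h : x (n + 1, i, s)) :
    ∃ e, (x (0, i, e) ∨ x (0, i + 1, e)) ∧ s + tailPos n ≤ e ∧ e < s + blockLen (n + 1) ∧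
      (∀ z, (x (0, i, z) ∨ x (0, i + 1, z)) → s ≤ z → z < s + blockLen (n + 1) → z ≤ e) ∧
      (∀ z, (x (0, i, z) ∨ x (0, i + 1, z)) → s ≤ z → z < e →
        ∃ z', (x (0, i, z') ∨ x (0, i + 1, z')) ∧ z < z' ∧ z' ≤ z + 6 * blockLen n) ∧
      (∀ z, (x (0, i, z) ∨ x (0, i + 1, z)) → e < z → e + 6 * blockLen n < z) := by
  have hl := tailPos_add_le n
  have hl1 := tailPos_eq n
  have hl2 := blockLen_pos n
  have hl3 := lastCopy_pos n
  obtain ⟨q, hq1, hq2, hq3⟩ := hx.exists_letter (hx.tail h)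
  obtain ⟨e, ⟨he, he1, he2⟩, hmax⟩ := Int.exists_greatest_of_bdd
    (P := fun z => (x (0, i, z) ∨ x (0, i + 1, z)) ∧ s ≤ z ∧ z < s + blockLen (n + 1))
    ⟨_, fun z hz => hz.2.2.le⟩ ⟨q, .inr hq3, by linarith, by linarith⟩
  have hqe : q ≤ e := hmax q ⟨.inr hq3, by linarith, by linarith⟩
  have he3 : e < s + tailPos n + blockLen n := by
    rcases he with he | he
    · exact hx.lt_of_mem_block h he (Nat.zero_le _) he1 he2
    · exact hx.lt_of_mem_block h he (Nat.zero_le _) he1 he2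
  refine ⟨e, he, by linarith, he2, fun z hz h1 h2 => hmax z ⟨hz, h1, h2⟩, fun z hz h1 h2 => ?_,
    fun z hz h1 => ?_⟩
  · have hcase : (∃ p ∈ copies n, s + p ≤ z ∧ z < s + p + blockLen n) ∨ s + tailPos n ≤ z := by
      rcases hz with hz | hz
      all_goals
        rcases hx.mem_constituent h hz (Nat.zero_le _) h1 (h2.trans he2) with
          ⟨p, hp, -, h3, h4⟩ | ⟨-, h3, -⟩
        · exact .inl ⟨p, hp, h3, h4⟩
        · exact .inr h3
    rcases hcase with ⟨p, hp, h3, h4⟩ | h3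
    -- The worst case is the last copy: the closing block starts 5l after it and has length l,
    -- whence the bound 6l.
    · by_cases hpl : p = lastCopy n
      · subst hpl
        exact ⟨q, .inr hq3, by linarith, by linarith⟩
      · obtain ⟨p', hp', h5, h6⟩ := exists_next_copy hp hpl
        obtain ⟨z', h7, h8, h9⟩ := hx.exists_letter (hx.copy h hp')
        exact ⟨z', .inl h9, by linarith, by linarith⟩
    · exact ⟨e, he, h2, by linarith⟩
  · by_contra hc
    push Not at hc
    linarith [hmax z ⟨hz, by linarith, by linarith⟩]

/-- Configurations with the same minimal index whose letters eventually agree are equal. -/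
theorem HasIndex.eq_of_eventually_eq (hxi : HasIndex x i) (hyi : HasIndex y i) (hx : IsConfig x)
    (hy : IsConfig y) {t₀ : ℤ} (h : ∀ t ≥ t₀, ∀ k, k = i ∨ k = i + 1 → x (0, k, t) = y (0, k, t)) :
    x = y := by
  refine hx.eq_of_common_blocks hy fun N => ?_
  obtain ⟨n₁, hn₁⟩ := hxi.exists_tail_gt hx (max (max t₀ (-t₀)) N)
  obtain ⟨n₂, hn₂⟩ := hyi.exists_tail_gt hy (max (max t₀ (-t₀)) N)
  set n := N + n₁ + n₂ with hn
  obtain ⟨s, hs, hs1, hs2⟩ := hn₁ n (by omega)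
  obtain ⟨r, hr, hr1, hr2⟩ := hn₂ n (by omega)
  have hY : ∀ t ≥ t₀, (x (0, i, t) ∨ x (0, i + 1, t)) ↔ (y (0, i, t) ∨ y (0, i + 1, t)) := by
    intro t ht
    rw [h t ht i (.inl rfl), h t ht (i + 1) (.inr rfl)]
  have hl := tailPos_add_le n
  have hl2 := blockLen_pos n
  obtain ⟨e, he, he1, he2, he3, he4, he5⟩ := hx.exists_last_letter hs
  obtain ⟨f, hf, hf1, hf2, hf3, hf4, hf5⟩ := hy.exists_last_letter hr
  -- If e < f, then y has a further letter within 6l after e, while x has none; the letters agree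
  -- there. The case f < e is symmetric.
  have hef : e = f := by
    rcases lt_trichotomy e f with hlt | heq | hlt
    · obtain ⟨z, hz, hz1, hz2⟩ := hf4 e ((hY e (by omega)).1 he) (by omega) hlt
      linarith [he5 z ((hY z (by omega)).2 hz) hz1]
    · exact heq
    · obtain ⟨z, hz, hz1, hz2⟩ := he4 f ((hY f (by omega)).2 hf) (by omega) hlt
      linarith [hf5 z ((hY z (by omega)).1 hz) hz1]
  subst hef
  -- Transporting the last letter of one block into the other compares the two starting positions.
  have h1 : e - s + r ≤ e := by
    refine hf3 _ ?_ (by omega) (by omega)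
    exact he.imp (hx.same_content hy (Nat.zero_le _) hs hr (by omega) he2)
      (hx.same_content hy (Nat.zero_le _) hs hr (by omega) he2)
  have h2 : e - r + s ≤ e := by
    refine he3 _ ?_ (by omega) (by omega)
    exact hf.imp (hy.same_content hx (Nat.zero_le _) hr hs (by omega) hf2)
      (hy.same_content hx (Nat.zero_le _) hr hs (by omega) hf2)
  obtain rfl : s = r := by omega
  exact ⟨n + 1, by omega, i, s, hs, hr, by omega, by omega⟩

/-- The letters of configurations with different minimal indices do not eventually agree. -/
theorem HasIndex.not_eventually_eq (hxi : HasIndex x i) (hyj : HasIndex y j) (hx : IsConfig x)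
    (hy : IsConfig y) (hij : i < j) {t₀ : ℤ}
    (h : ∀ t ≥ t₀, ∀ k, k = i ∨ k = i + 1 → x (0, k, t) = y (0, k, t)) : False := by
  have hxi0 : ∀ t ≥ t₀, ¬ x (0, i, t) := fun t ht hc => by
    rw [h t ht i (.inl rfl)] at hc
    exact absurd (hyj.le _ _ _ hc) (by omega)
  have hyk : ∀ t ≥ t₀, (x (0, i + 1, t) ↔ y (0, i + 1, t)) := fun t ht => by
    rw [h t ht (i + 1) (.inr rfl)]
  obtain ⟨n₁, hn₁⟩ := hxi.exists_tail_gt hx (max t₀ 0)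
  obtain ⟨n₂, hn₂⟩ := hxi.exhaust (max t₀ 0)
  set m := n₁ + n₂
  obtain ⟨s, hs, hs1, hs2⟩ := hn₁ m (by omega)
  obtain ⟨r, hr, hr1, hr2⟩ := hn₁ (m + 1) (by omega)
  have hlm := tailPos_add_le m
  have hlm2 := blockLen_pos m
  have hl := tailPos_add_le (m + 1)
  have hl1 := tailPos_eq (m + 1)
  have hl2 := blockLen_pos (m + 1)
  have hl3 := lastCopy_pos (m + 1)
  have hs3 : max t₀ 0 < s + blockLen (m + 1) := by linarith
  obtain ⟨p, hp, hsp⟩ := hxi.exists_copy hx hs (by omega) (by omega) hr (by omega) (by omega)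
  generalize hn : m + 1 = n at *
  -- Any later copy would contain a letter i beyond t₀, where none is left.
  have hpl : p = lastCopy n := by
    by_contra hpl
    obtain ⟨p', hp', h5, h6⟩ := exists_next_copy hp hpl
    obtain ⟨z, h7, h8, h9⟩ := hx.exists_letter (hx.copy hr hp')
    exact hxi0 z (by omega) h9
  subst hpl
  have htail : x (m, i + 1, s + tailPos m) := by
    subst hn
    exact hx.tail hs
  obtain ⟨z₀, hz₀, hz₀', hz₀x⟩ := hx.exists_letter htail
  have hj : j = i + 1 := by
    have := hyj.le _ _ _ ((hyk z₀ (by omega)).1 hz₀x)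
    omega
  subst hj
  obtain ⟨e, ⟨he, he1, he2⟩, hmax⟩ := Int.exists_greatest_of_bdd
    (P := fun z => x (0, i + 1, z) ∧ s ≤ z ∧ z < s + blockLen n)
    ⟨_, fun z hz => hz.2.2.le⟩ ⟨z₀, hz₀x, by omega, by omega⟩
  have hez : z₀ ≤ e := hmax z₀ ⟨hz₀x, by omega, by omega⟩
  obtain ⟨w, hw1, hw2, hwx⟩ := hx.exists_letter (hx.tail hr)
  -- The letter e lies in the last copy, so the next letter i+1 is in the closing block, which
  -- starts 4l after the end of that copy.
  have hgap : ∀ z, x (0, i + 1, z) → e < z → e + 4 * blockLen n < z := by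
    intro z hz h1
    by_contra hc
    rcases hx.mem_constituent hr hz (Nat.zero_le _) (by omega) (by omega) with
      ⟨p, hp, -, h3, h4⟩ | ⟨-, h3, -⟩
    · rcases (le_lastCopy hp).lt_or_eq with hlt | rfl
      · have := copies_apart hp (lastCopy_mem_copies n) hlt
        omega
      · have := hmax z ⟨hz, by omega, by omega⟩
        omega
    · omega
  have hye := (hyk e (by omega)).1 he
  have hyw := (hyk w (by omega)).1 hwx
  obtain ⟨i₁, hi₁, b, hb, hb1, hb2⟩ := hy.exists_ancestor hye (Nat.zero_le n)
  obtain rfl : i₁ = i + 1 := le_antisymm hi₁ (hyj.le _ _ _ hb)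
  rcases hy.exists_parent hb with ⟨c, hc, p, hp, rfl⟩ | ⟨i', c, hi', hc, -⟩
  -- In y the block around e has minimal index i+1. If it is not the last copy, the next copy
  -- repeats the letter within 2l, against the gap. If it is the last copy, w falls into the closing
  -- block, whose index i+2 is too large.
  · by_cases hpl : p = lastCopy n
    · subst hpl
      have h1 := hgap w hwx (by omega)
      rcases hy.mem_constituent hc hyw (Nat.zero_le _) (by omega) (by omega) with
        ⟨p, hp, -, h3, h4⟩ | ⟨h2, h3, h4⟩
      · have := le_lastCopy hp
        omega
      · have := hy.index_le h2 hyw (Nat.zero_le _) h3 h4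
        omega
    · obtain ⟨p', hp', h5, h6⟩ := exists_next_copy hp hpl
      have h7 := hy.same_content hy (Nat.zero_le _) hb (hy.copy hc hp') hb1 hb2 hye
      have h8 := hgap _ ((hyk _ (by omega)).2 h7) (by omega)
      omega
  · have := hyj.le _ _ _ hc
    omega

/-- Two configurations have arbitrarily late long common empty intervals. -/
theorem HasIndex.exists_common_gap (hxi : HasIndex x i) (hx : IsConfig x) (hy : IsConfig y)
    (N : ℕ) (t₀ : ℤ) : ∃ t ≥ t₀, ∀ m ≤ N, ∀ k (q : ℤ), |q| ≤ N →
      ¬ x (m, k, q + t) ∧ ¬ y (m, k, q + t) := by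
  obtain ⟨n₁, hn₁⟩ := hxi.exists_tail_gt hx t₀
  set M := n₁ + N + 1
  obtain ⟨s, hs, -, hs1⟩ := hn₁ M (by omega)
  have hM := tailPos_add_le M
  have hM1 := blockLen_pos M
  have hN := tailPos_add_le N
  have hN1 := lt_blockLen N
  have hN2 := tailPos_eq N
  have hN3 := lastCopy_pos N
  have hM2 : 0 < tailPos M := by linarith [tailPos_eq M, lastCopy_pos M]
  have hNM : blockLen (N + 1) ≤ blockLen M := blockLen_strictMono.monotone (by omega)
  obtain ⟨a, ha⟩ : ∃ a, a = s + tailPos M + blockLen M := ⟨_, rfl⟩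
  have hxa : ∀ m ≤ N, ∀ k q, a ≤ q → q < a + 10 * blockLen M → ¬ x (m, k, q) := by
    intro m hm k q h1 h2 h3
    have := hx.lt_of_mem_block hs h3 (by omega) (by omega) (by omega)
    omega
  -- Either a block of y of level N+1 starts early in the gap of x, and its empty end serves, or
  -- none does, and y is empty up to level N on the second stretch of length `blockLen (N + 1)`.
  by_cases hcase : ∃ j r, y (N + 1, j, r) ∧ a ≤ r ∧ r < a + 2 * blockLen (N + 1)
  · obtain ⟨j, r, hr, hr1, hr2⟩ := hcase
    refine ⟨r + tailPos N + blockLen N + N, by omega, fun m hm k q hq => ⟨?_, fun h => ?_⟩⟩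
    · rw [abs_le] at hq
      exact hxa m hm k _ (by omega) (by omega)
    · rw [abs_le] at hq
      have := hy.lt_of_mem_block hr h (by omega) (by omega) (by omega)
      omega
  · refine ⟨a + blockLen (N + 1) + N, by omega, fun m hm k q hq => ⟨?_, fun h => hcase ?_⟩⟩
    · rw [abs_le] at hq
      exact hxa m hm k _ (by omega) (by omega)
    · rw [abs_le] at hq
      obtain ⟨j, -, r, hr, hr1, hr2⟩ := hy.exists_ancestor h (show m ≤ N + 1 by omega)
      exact ⟨j, r, hr, by omega, by omega⟩

end

/-! ### A configuration with blocks of index zero at all levels -/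

/-- The blocks contained in the block of level `N` and index `0` that starts at `-N`. -/
inductive Descendant (N : ℕ) : ℕ → ℕ → ℤ → Prop
  | root : Descendant N N 0 (-N)
  | copy {n i : ℕ} {s p : ℤ} :
      Descendant N (n + 1) i s → p ∈ copies n → Descendant N n i (s + p)
  | tail {n i : ℕ} {s : ℤ} :
      Descendant N (n + 1) i s → Descendant N n (i + 1) (s + tailPos n)

namespace Descendant

variable {N n i : ℕ} {s : ℤ}

theorem level_le (h : Descendant N n i s) : n ≤ N := by
  induction h with
  | root => exact le_rfl
  | copy _ _ ih => omega
  | tail _ ih => omega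

/-- The root at -N is the first copy, at offset 1, in the root at -(N+1). -/
theorem succ (h : Descendant N n i s) : Descendant (N + 1) n i s := by
  induction h with
  | root =>
    convert Descendant.copy (Descendant.root (N := N + 1)) (one_mem_copies N) using 1
    push_cast
    ring
  | copy _ hp ih => exact ih.copy hp
  | tail _ ih => exact ih.tail

theorem mono {M : ℕ} (hNM : N ≤ M) (h : Descendant N n i s) : Descendant M n i s := by
  induction M, hNM using Nat.le_induction with
  | base => exact h
  | succ M _ ih => exact ih.succ

theorem apart {i' : ℕ} {s' : ℤ} (h : Descendant N n i s) (h' : Descendant N n i' s') :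
    (i = i' ∧ s = s') ∨ s + blockLen n ≤ s' ∨ s' + blockLen n ≤ s := by
  obtain ⟨k, hk⟩ := Nat.exists_eq_add_of_le h.level_le
  induction k generalizing n i s i' s' with
  | zero =>
    obtain rfl : n = N := by omega
    cases h with
    | copy h _ => exact absurd h.level_le (by omega)
    | tail h => exact absurd h.level_le (by omega)
    | root =>
      cases h' with
      | copy h _ => exact absurd h.level_le (by omega)
      | tail h => exact absurd h.level_le (by omega)
      | root => exact .inl ⟨rfl, rfl⟩
  | succ k ih =>
    have hl := tailPos_add_le n
    have hl1 := tailPos_eq n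
    have hl2 := blockLen_pos n
    have hl3 := lastCopy_pos n
    cases h with
    | root => omega
    | @copy _ _ r p h hp =>
      have hp1 := one_le_of_mem_copies hp
      have hp2 := le_lastCopy hp
      cases h' with
      | root => omega
      | @copy _ _ r' p' h' hp' =>
        have hp1' := one_le_of_mem_copies hp'
        have hp2' := le_lastCopy hp'
        rcases ih h h' (by omega) with ⟨rfl, rfl⟩ | h | h
        · rcases lt_trichotomy p p' with hlt | rfl | hlt
          · have := copies_apart hp hp' hlt
            omega
          · exact .inl ⟨rfl, rfl⟩
          · have := copies_apart hp' hp hlt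
            omega
        · omega
        · omega
      | @tail _ _ r' h' =>
        rcases ih h h' (by omega) with ⟨rfl, rfl⟩ | h | h <;> omega
    | @tail _ _ r h =>
      cases h' with
      | root => omega
      | @copy _ _ r' p' h' hp' =>
        have hp1' := one_le_of_mem_copies hp'
        have hp2' := le_lastCopy hp'
        rcases ih h h' (by omega) with ⟨rfl, rfl⟩ | h | h <;> omega
      | @tail _ _ r' h' =>
        rcases ih h h' (by omega) with ⟨rfl, rfl⟩ | h | h <;> omega

end Descendant

open Classical in
/-- The union of an increasing sequence of nested blocks of index `0`. -/
noncomputable def baseConfig (c : ℕ × ℕ × ℤ) : Bool :=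
  decide (∃ N, Descendant N c.1 c.2.1 c.2.2)

theorem baseConfig_apply {n i : ℕ} {s : ℤ} :
    baseConfig (n, i, s) ↔ ∃ N, Descendant N n i s := by
  simp [baseConfig]

theorem baseConfig_root (n : ℕ) : baseConfig (n, 0, -n) := baseConfig_apply.2 ⟨n, .root⟩

theorem isConfig_baseConfig : IsConfig baseConfig where
  mem_iff n i s := by
    constructor
    · intro h
      obtain ⟨N, h⟩ := baseConfig_apply.1 h
      cases h.succ with
      | root => exact absurd h.level_le (by omega)
      | @copy _ _ r p h1 hp =>
        exact .inl ⟨p, hp, by rw [add_sub_cancel_right]; exact baseConfig_apply.2 ⟨_, h1⟩⟩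
      | @tail _ j r h1 =>
        exact .inr ⟨j, rfl, by rw [add_sub_cancel_right]; exact baseConfig_apply.2 ⟨_, h1⟩⟩
    · rintro (⟨p, hp, h⟩ | ⟨j, rfl, h⟩)
      · obtain ⟨N, h⟩ := baseConfig_apply.1 h
        exact baseConfig_apply.2 ⟨N, by simpa using h.copy hp⟩
      · obtain ⟨N, h⟩ := baseConfig_apply.1 h
        exact baseConfig_apply.2 ⟨N, by simpa using h.tail⟩
  apart n i s i' s' h h' := by
    obtain ⟨N, h⟩ := baseConfig_apply.1 h
    obtain ⟨N', h'⟩ := baseConfig_apply.1 h'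
    exact (h.mono (le_max_left N N')).apart (h'.mono (le_max_right N N'))

theorem IsConfig.shift {x : ℕ × ℕ × ℤ → Bool} (hx : IsConfig x) (t : ℤ) :
    IsConfig fun c => x (c.1, c.2.1, c.2.2 + t) where
  mem_iff n i s := by
    simpa only [sub_add_eq_add_sub] using hx.mem_iff n i (s + t)
  apart n i s i' s' h h' := by
    have := hx.apart n i (s + t) i' (s' + t) h h'
    omega

/-! ### Distances between blocks -/

/-- Every block of level `m` contains a block of level `n` and the same index at offset `o`. -/
def IsBlockOffset (n m : ℕ) (o : ℤ) : Prop :=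
  ∀ ⦃x⦄, IsConfig x → ∀ i s, x (m, i, s) → x (n, i, s + o)

/-- Every block of level `m` contains two blocks of level `n` and the same index at distance `d`. -/
def IsBlockDistance (n m : ℕ) (d : ℤ) : Prop :=
  ∃ o o', IsBlockOffset n m o ∧ IsBlockOffset n m o' ∧ o' - o = d

theorem isBlockOffset_of_mem_copies {n : ℕ} {p : ℤ} (hp : p ∈ copies n) :
    IsBlockOffset n (n + 1) p := fun _ hx _ _ h => hx.copy h hp

theorem IsBlockOffset.trans {n m k : ℕ} {o o' : ℤ} (h : IsBlockOffset n m o)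
    (h' : IsBlockOffset m k o') : IsBlockOffset n k (o' + o) := fun _ hx i s hs => by
  rw [← add_assoc]
  exact h hx i _ (h' hx i s hs)

theorem isBlockOffset_add (n k : ℕ) : IsBlockOffset n (n + k) k := by
  induction k with
  | zero => exact fun _ _ _ _ h => by simpa using h
  | succ k ih =>
    rw [Nat.cast_succ, add_comm (k : ℤ)]
    exact ih.trans (isBlockOffset_of_mem_copies (one_mem_copies (n + k)))

theorem IsBlockDistance.neg {n m : ℕ} {d : ℤ} (h : IsBlockDistance n m d) :
    IsBlockDistance n m (-d) := by
  obtain ⟨o, o', ho, ho', rfl⟩ := h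
  exact ⟨o', o, ho', ho, by ring⟩

theorem IsBlockDistance.add {n m k : ℕ} {d e : ℤ} (h : IsBlockDistance n m d)
    (h' : IsBlockDistance m k e) : IsBlockDistance n k (e + d) := by
  obtain ⟨o, o', ho, ho', rfl⟩ := h
  obtain ⟨p, p', hp, hp', rfl⟩ := h'
  exact ⟨_, _, ho.trans hp, ho'.trans hp', by ring⟩

theorem isBlockDistance_of_mem_copies {n : ℕ} {p q d : ℤ} (hp : p ∈ copies n) (hq : q ∈ copies n)
    (h : q - p = d) : IsBlockDistance n (n + 1) d :=
  ⟨p, q, isBlockOffset_of_mem_copies hp, isBlockOffset_of_mem_copies hq, h⟩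

theorem isBlockDistance_mul {n : ℕ} {r : ℤ} (h0 : 0 ≤ r) (h1 : r ≤ 31 * blockLen n) :
    IsBlockDistance n (n + 1) (r * blockLen n) :=
  isBlockDistance_of_mem_copies (one_mem_copies n)
    (mem_copies.2 (.inl ⟨r, h0, h1, rfl⟩)) (by ring)

theorem isBlockDistance_mul_add_stretch {n : ℕ} {r : ℤ} (h0 : 1 ≤ r) (h1 : r ≤ 31 * blockLen n) :
    IsBlockDistance n (n + 1) (r * blockLen n + stretch n) :=
  isBlockDistance_of_mem_copies
    (mem_copies.2 (.inl ⟨31 * blockLen n + 1 - r, by linarith, by linarith, rfl⟩))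
    (mem_copies.2 (.inr ⟨0, le_rfl, (blockLen_pos n).le, rfl⟩)) (by ring)

/-- The two arithmetic progressions of copies realize an interval of distances. -/
theorem isBlockDistance_succ {n : ℕ} {d : ℤ}
    (h0 : blockLen n + stretch n + blockLen n ^ 2 ≤ d)
    (h1 : d ≤ blockLen n + stretch n + 31 * blockLen n ^ 2) : IsBlockDistance n (n + 1) d := by
  have hl := blockLen_pos n
  -- Write e = ql + r with 0 ≤ r < l. Index r in the second progression contributes r(l+1), and
  -- moving the first index by r cancels rl.
  obtain ⟨e, he⟩ : ∃ e, e = d - blockLen n - stretch n := ⟨_, rfl⟩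
  have hr0 := Int.emod_nonneg e hl.ne'
  have hr1 := Int.emod_lt_of_pos e hl
  have hdiv := Int.mul_ediv_add_emod e (blockLen n)
  have hq0 : blockLen n ≤ e / blockLen n := (Int.le_ediv_iff_mul_le hl).2 (by nlinarith)
  have hq1 : e / blockLen n ≤ 31 * blockLen n :=
    Int.le_of_lt_add_one ((Int.ediv_lt_iff_lt_mul hl).2 (by nlinarith))
  refine isBlockDistance_of_mem_copies
    (mem_copies.2 (.inl ⟨31 * blockLen n - (e / blockLen n - e % blockLen n), by linarith,
      by linarith, rfl⟩))
    (mem_copies.2 (.inr ⟨e % blockLen n, hr0, hr1.le, rfl⟩)) ?_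
  linear_combination hdiv + he

/-- An interval of distances extends to the next level. -/
theorem isBlockDistance_extend {n m : ℕ} {A B : ℤ} (hA : 2 * A ≤ stretch m)
    (hB : 3 * blockLen m ≤ 4 * B) (hA0 : 0 ≤ A)
    (h : ∀ d, A ≤ d → d ≤ B → IsBlockDistance n m d) {d : ℤ} (hd : A ≤ d)
    (hd' : d ≤ B + 31 * blockLen m ^ 2) : IsBlockDistance n (m + 1) d := by
  have hl := eight_le_blockLen m
  have hl0 := blockLen_pos m
  have hs := eight_mul_stretch m
  rcases le_or_gt d B with hdB | hdB
  · simpa using (h d hd hdB).add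
      (isBlockDistance_mul (n := m) (r := 0) le_rfl (by linarith))
  -- Since 2B exceeds `blockLen m`, the intervals of radius B around its multiples overlap.
  obtain ⟨r, hr1, hr2, hr3, hr4⟩ : ∃ r, 1 ≤ r ∧ r ≤ 31 * blockLen m ∧
      -B ≤ d - r * blockLen m ∧ d - r * blockLen m ≤ B := by
    have h1 := Int.ediv_mul_le (d + B) hl0.ne'
    have h2 := Int.lt_ediv_add_one_mul_self (d + B) hl0
    have h3 : 1 ≤ (d + B) / blockLen m := (Int.le_ediv_iff_mul_le hl0).2 (by linarith)
    rcases le_or_gt ((d + B) / blockLen m) (31 * blockLen m) with h4 | h4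
    · exact ⟨_, h3, h4, by linarith, by linarith⟩
    · exact ⟨31 * blockLen m, by linarith, le_rfl, by nlinarith, by nlinarith⟩
  rcases le_or_gt A (d - r * blockLen m) with h1 | h1
  · convert (h _ h1 hr4).add (isBlockDistance_mul (by linarith) hr2) using 1
    ring
  rcases le_or_gt (d - r * blockLen m) (-A) with h2 | h2
  · convert (h (-(d - r * blockLen m)) (by linarith) (by linarith)).neg.add
      (isBlockDistance_mul (by linarith) hr2) using 1
    ring
  -- The remainder is too small to be a known distance. Overshooting by `stretch m` and stepping
  -- back leaves a distance between A and B, because 2A ≤ `stretch m`.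
  · convert (h (stretch m - (d - r * blockLen m)) (by linarith) (by linarith)).neg.add
      (isBlockDistance_mul_add_stretch hr1 hr2) using 1
    ring

theorem exists_isBlockDistance (n : ℕ) :
    ∃ A, ∀ d ≥ A, ∃ m, IsBlockDistance n m d := by
  obtain ⟨A, hA⟩ : ∃ A, A = blockLen n + stretch n + blockLen n ^ 2 := ⟨_, rfl⟩
  have hl := eight_le_blockLen n
  have hs := eight_mul_stretch n
  have key : ∀ k : ℕ, ∃ B, 3 * blockLen (n + 1 + k) ≤ 4 * B ∧
      ∀ d, A ≤ d → d ≤ B → IsBlockDistance n (n + 1 + k) d := by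
    intro k
    induction k with
    | zero =>
      refine ⟨blockLen n + stretch n + 31 * blockLen n ^ 2, ?_, fun d h0 h1 =>
        isBlockDistance_succ (hA ▸ h0) h1⟩
      rw [add_zero, blockLen_succ]
      nlinarith
    | succ k ih =>
      obtain ⟨B, hB, h⟩ := ih
      have hm : blockLen (n + 1) ≤ blockLen (n + 1 + k) :=
        blockLen_strictMono.monotone (by omega)
      have hsm := eight_mul_stretch (n + 1 + k)
      have hlm := eight_le_blockLen (n + 1 + k)
      refine ⟨B + 31 * blockLen (n + 1 + k) ^ 2, ?_, fun d h0 h1 =>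
        isBlockDistance_extend ?_ hB ?_ h h0 h1⟩
      · rw [← add_assoc, blockLen_succ]
        nlinarith
      · rw [blockLen_succ] at hm
        nlinarith
      · rw [hA]
        nlinarith
  refine ⟨A, fun d hd => ?_⟩
  -- The factor 2 compensates for B being only bounded below by 3/4 of the block length.
  obtain ⟨B, hB, h⟩ := key (2 * d.toNat)
  refine ⟨_, h d hd ?_⟩
  have := lt_blockLen (n + 1 + 2 * d.toNat)
  push_cast at this
  omega

/-- Blocks of index `0` occur at all large distances. -/
theorem exists_config_blocks_at (n : ℕ) (a b : ℤ) : ∃ N : ℕ, ∀ k ≥ N,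
    ∃ x, IsConfig x ∧ x (n, 0, a) ∧ x (n, 0, b + k) := by
  obtain ⟨A, hA⟩ := exists_isBlockDistance n
  refine ⟨(A + a - b).toNat, fun k hk => ?_⟩
  obtain ⟨m, o, o', ho, ho', hd⟩ := hA (b + k - a) (by omega)
  refine ⟨_, isConfig_baseConfig.shift (-m + o - a), ?_, ?_⟩
  · convert ho isConfig_baseConfig 0 _ (baseConfig_root m) using 4
    ring
  · convert ho' isConfig_baseConfig 0 _ (baseConfig_root m) using 4
    linarith

/-! ### Arbitrary pairs, including the empty configuration -/

theorem IsConfig.exists_common_gap {x y : ℕ × ℕ × ℤ → Bool} (hx : IsConfig x) (hy : IsConfig y)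
    (hxy : x ≠ y) (N : ℕ) (t₀ : ℤ) : ∃ t ≥ t₀, ∀ m ≤ N, ∀ k (q : ℤ), |q| ≤ N →
      ¬ x (m, k, q + t) ∧ ¬ y (m, k, q + t) := by
  by_cases h : ∃ c, x c
  · obtain ⟨i, hi⟩ := hx.exists_hasIndex h
    exact hi.exists_common_gap hx hy N t₀
  by_cases h' : ∃ c, y c
  · obtain ⟨i, hi⟩ := hy.exists_hasIndex h'
    obtain ⟨t, ht, ht'⟩ := hi.exists_common_gap hy hx N t₀
    exact ⟨t, ht, fun m hm k q hq => (ht' m hm k q hq).symm⟩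
  · push Not at h h'
    exact absurd (funext fun c => (Bool.eq_false_of_not_eq_true (h c)).trans
      (Bool.eq_false_of_not_eq_true (h' c)).symm) hxy

/-- The alphabet is infinite, so the time from which letters agree may depend on the letter. This
suffices because the comparison involves only the two letters i and i+1. -/
theorem IsConfig.eq_of_eventually_eq {x y : ℕ × ℕ × ℤ → Bool} (hx : IsConfig x) (hy : IsConfig y)
    (h : ∀ k, ∃ t₀ : ℤ, ∀ t ≥ t₀, x (0, k, t) = y (0, k, t)) : x = y := by
  choose τ hτ using h
  have hpair : ∀ i, ∀ t ≥ max (τ i) (τ (i + 1)), ∀ k, k = i ∨ k = i + 1 →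
      x (0, k, t) = y (0, k, t) := by
    rintro i t ht k (rfl | rfl)
    · exact hτ _ _ ((le_max_left _ _).trans ht)
    · exact hτ _ _ ((le_max_right _ _).trans ht)
  by_cases hx0 : ∃ c, x c <;> by_cases hy0 : ∃ c, y c
  · obtain ⟨i, hi⟩ := hx.exists_hasIndex hx0
    obtain ⟨j, hj⟩ := hy.exists_hasIndex hy0
    rcases lt_trichotomy i j with hij | rfl | hij
    · exact (hi.not_eventually_eq hj hx hy hij (hpair i)).elim
    · exact hi.eq_of_eventually_eq hj hx hy (hpair i)
    · exact (hj.not_eventually_eq hi hy hx hij fun t ht k hk => (hpair j t ht k hk).symm).elim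
  · obtain ⟨i, hi⟩ := hx.exists_hasIndex hx0
    obtain ⟨t, ht, h⟩ := hi.exists_letter_ge hx (τ (i + 1))
    exact absurd ⟨_, (hτ _ t ht).symm.trans h⟩ hy0
  · obtain ⟨i, hi⟩ := hy.exists_hasIndex hy0
    obtain ⟨t, ht, h⟩ := hi.exists_letter_ge hy (τ (i + 1))
    exact absurd ⟨_, (hτ _ t ht).trans h⟩ hx0
  · push Not at hx0 hy0
    exact funext fun c => (Bool.eq_false_of_not_eq_true (hx0 c)).trans
      (Bool.eq_false_of_not_eq_true (hy0 c)).symm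

/-! ### The space of configurations -/

/-- The space of all configurations, with the topology of pointwise convergence. -/
abbrev ConfigSpace : Type := {x : ℕ × ℕ × ℤ → Bool // IsConfig x}

theorem isClopen_config_apply (c : ℕ × ℕ × ℤ) :
    IsClopen {x : ℕ × ℕ × ℤ → Bool | x c = true} :=
  (isClopen_discrete {true}).preimage (continuous_apply c)

theorem isClopen_forall_iff {X : Type*} [TopologicalSpace X] {P Q : X → Prop}
    (hP : IsClopen {x | P x}) (hQ : IsClopen {x | Q x}) : IsClopen {x | P x ↔ Q x} := by
  convert (hP.inter hQ).union (hP.compl.inter hQ.compl) using 1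
  ext x
  simp only [mem_ofPred_eq, mem_union, mem_inter_iff, mem_compl_iff]
  tauto

theorem isClosed_isConfig : IsClosed {x | IsConfig x} := by
  have h1 : IsClosed {x : ℕ × ℕ × ℤ → Bool | ∀ n i s, x (n, i, s) ↔
      (∃ p ∈ copies n, x (n + 1, i, s - p)) ∨
        ∃ i', i = i' + 1 ∧ x (n + 1, i', s - tailPos n)} := by
    simp only [ofPred_forall]
    refine isClosed_iInter fun n => isClosed_iInter fun i => isClosed_iInter fun s =>
      (isClopen_forall_iff (isClopen_config_apply _) ?_).isClosed
    -- A block has only finitely many possible parents, so the condition is clopen.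
    refine IsClopen.union (s := {x : ℕ × ℕ × ℤ → Bool | ∃ p ∈ copies n, x (n + 1, i, s - p)})
      (t := {x : ℕ × ℕ × ℤ → Bool | ∃ i', i = i' + 1 ∧ x (n + 1, i', s - tailPos n)}) ?_ ?_
    · convert (copies n).finite_toSet.isClopen_biUnion
        (f := fun p => {x : ℕ × ℕ × ℤ → Bool | x (n + 1, i, s - p) = true})
        fun p _ => isClopen_config_apply _ using 1
      ext x
      simp
    · cases i with
      | zero => simpa using isClopen_empty
      | succ i =>
        convert isClopen_config_apply (n + 1, i, s - tailPos n) using 1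
        ext x
        simp
  have h2 : IsClosed {x : ℕ × ℕ × ℤ → Bool | ∀ n i s i' s', x (n, i, s) → x (n, i', s') →
      (i = i' ∧ s = s') ∨ s + blockLen n ≤ s' ∨ s' + blockLen n ≤ s} := by
    simp only [ofPred_forall]
    refine isClosed_iInter fun n => isClosed_iInter fun i => isClosed_iInter fun s =>
      isClosed_iInter fun i' => isClosed_iInter fun s' => ?_
    exact isClosed_imp (isClopen_config_apply _).isOpen
      (isClosed_imp (isClopen_config_apply _).isOpen isClosed_const)
  convert h1.inter h2 using 1
  ext x
  exact ⟨fun h => ⟨h.1, h.2⟩, fun h => ⟨h.1, h.2⟩⟩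

instance : CompactSpace ConfigSpace := isCompact_iff_compactSpace.1 isClosed_isConfig.isCompact

/-- The shift of configurations. -/
def configShift : ConfigSpace ≃ₜ ConfigSpace where
  toFun x := ⟨fun c => x.1 (c.1, c.2.1, c.2.2 + 1), x.2.shift 1⟩
  invFun x := ⟨fun c => x.1 (c.1, c.2.1, c.2.2 + -1), x.2.shift (-1)⟩
  left_inv x := by simp
  right_inv x := by simp
  continuous_toFun := Continuous.subtype_mk (continuous_pi fun c =>
    (continuous_apply (c.1, c.2.1, c.2.2 + 1)).comp continuous_subtype_val) _
  continuous_invFun := Continuous.subtype_mk (continuous_pi fun c =>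
    (continuous_apply (c.1, c.2.1, c.2.2 + -1)).comp continuous_subtype_val) _

theorem configShift_iterate_apply (k : ℕ) (x : ConfigSpace) (n i : ℕ) (s : ℤ) :
    (configShift^[k] x).1 (n, i, s) = x.1 (n, i, s + k) := by
  induction k generalizing x with
  | zero => simp
  | succ k ih =>
    rw [Function.iterate_succ_apply, ih]
    rw [Nat.cast_succ, ← add_assoc]
    rfl

theorem continuous_config_apply (c : ℕ × ℕ × ℤ) : Continuous fun x : ConfigSpace => x.1 c :=
  (continuous_apply c).comp continuous_subtype_val

/-- The configuration without blocks. -/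
def emptyConfig : ConfigSpace := ⟨fun _ => false, by simp, by simp⟩

/-! ### Neighbourhoods, mixing and absence of isolated points -/

theorem ConfigSpace.exists_window {U : Set ConfigSpace} (hU : IsOpen U) {x : ConfigSpace}
    (hx : x ∈ U) : ∃ N : ℕ, ∀ y : ConfigSpace,
      (∀ m ≤ N, ∀ k (q : ℤ), |q| ≤ N → y.1 (m, k, q) = x.1 (m, k, q)) → y ∈ U := by
  obtain ⟨V, hV, rfl⟩ := isOpen_induced_iff.1 hU
  obtain ⟨F, u, hu, hFu⟩ := isOpen_pi_iff.1 hV x.1 hx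
  refine ⟨F.sup fun c => c.1 + c.2.2.natAbs, fun y hy => hFu fun c hc => ?_⟩
  have hle : c.1 + c.2.2.natAbs ≤ F.sup fun c => c.1 + c.2.2.natAbs :=
    Finset.le_sup (f := fun c : ℕ × ℕ × ℤ => c.1 + c.2.2.natAbs) hc
  have := hy c.1 (by omega) c.2.1 c.2.2 (by rw [Int.abs_eq_natAbs]; omega)
  rw [show c = (c.1, c.2.1, c.2.2) from rfl, this]
  exact (hu c hc).2

/-- Following closing blocks i times raises the index by i, so every type of block occurs inside
blocks of index 0. -/
theorem IsConfig.exists_block_of_level_zero (n i : ℕ) : ∃ t : ℤ, ∀ ⦃x⦄, IsConfig x → ∀ j s,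
    x (n + i, j, s) → x (n, j + i, s + t) := by
  induction i with
  | zero => exact ⟨0, fun _ _ _ _ h => by simpa using h⟩
  | succ i ih =>
    obtain ⟨t, ht⟩ := ih
    refine ⟨tailPos (n + i) + t, fun x hx j s h => ?_⟩
    convert ht hx _ _ (hx.tail h) using 4
    · omega
    · ring

/-- A large block of minimal index determines a finite window and lies in a block of index 0. The
empty configuration is first replaced by a shift of `baseConfig` with a long gap at the origin. -/
theorem ConfigSpace.exists_block_subset {U : Set ConfigSpace} (hU : IsOpen U) (hne : U.Nonempty) :
    ∃ n a, ∀ y : ConfigSpace, y.1 (n, 0, a) → y ∈ U := by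
  obtain ⟨x, hxU, hx⟩ : ∃ x ∈ U, ∃ c, x.1 c := by
    obtain ⟨x, hx⟩ := hne
    by_cases h : ∃ c, x.1 c
    · exact ⟨x, hx, h⟩
    obtain ⟨N, hN⟩ := ConfigSpace.exists_window hU hx
    have hb : baseConfig ≠ fun _ => false := fun h => by
      have := baseConfig_root 0
      rw [h] at this
      exact Bool.false_ne_true this
    obtain ⟨t, -, ht⟩ := isConfig_baseConfig.exists_common_gap emptyConfig.2 hb N 0
    refine ⟨⟨_, isConfig_baseConfig.shift t⟩, hN _ fun m hm k q hq => ?_, (0, 0, -t), ?_⟩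
    · push Not at h
      exact (Bool.eq_false_of_not_eq_true (ht m hm k q hq).1).trans
        (Bool.eq_false_of_not_eq_true (h _)).symm
    · simpa using baseConfig_root 0
  obtain ⟨N, hN⟩ := ConfigSpace.exists_window hU hxU
  obtain ⟨i, hi⟩ := x.2.exists_hasIndex hx
  obtain ⟨n₁, hn₁⟩ := hi.exhaust N
  obtain ⟨s, h1, h2, h3⟩ := hn₁ (n₁ + N) (by omega)
  obtain ⟨t, ht⟩ := IsConfig.exists_block_of_level_zero (n₁ + N) i
  refine ⟨n₁ + N + i, s - t, fun y hy => hN y fun m hm k q hq => ?_⟩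
  have hys : y.1 (n₁ + N, i, s) := by simpa using ht y.2 0 _ hy
  rw [abs_le] at hq
  rw [Bool.eq_iff_iff]
  constructor
  · intro hq'
    have := y.2.same_content x.2 (by omega) hys h1 (by omega) (by omega) hq'
    rwa [sub_add_cancel] at this
  · intro hq'
    have := x.2.same_content y.2 (by omega) h1 hys (by omega) (by omega) hq'
    rwa [sub_add_cancel] at this

theorem isTopologicallyMixing_configShift : IsTopologicallyMixing configShift := by
  intro U V hU hV hUne hVne
  obtain ⟨n, a, hn⟩ := ConfigSpace.exists_block_subset hU hUne
  obtain ⟨m, b, hm⟩ := ConfigSpace.exists_block_subset hV hVne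
  -- The common level n+m contains level n at offset m and level m at offset n.
  obtain ⟨N, hN⟩ := exists_config_blocks_at (n + m) (a - m) (b - n)
  refine ⟨N, fun k hk => ?_⟩
  obtain ⟨x, hx, h1, h2⟩ := hN k hk
  refine ⟨_, ⟨⟨x, hx⟩, hn _ ?_, rfl⟩, hm _ ?_⟩
  · simpa using isBlockOffset_add n m hx 0 _ h1
  · rw [configShift_iterate_apply]
    rw [add_comm n m] at h2
    convert isBlockOffset_add m n hx 0 _ h2 using 4
    ring

/-- By mixing, an isolated point would be fixed by two consecutive iterates, so its blocks would
recur at distance 1 and overlap. -/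
theorem not_isOpen_singleton_config (x : ConfigSpace) : ¬ IsOpen {x} := by
  intro hx
  obtain ⟨n, a, hn⟩ := ConfigSpace.exists_block_subset hx (singleton_nonempty x)
  obtain ⟨N, hN⟩ := isTopologicallyMixing_configShift _ _ hx hx (singleton_nonempty x)
    (singleton_nonempty x)
  have hfix : ∀ k ≥ N, configShift^[k] x = x := by
    intro k hk
    obtain ⟨_, ⟨y, rfl, rfl⟩, h⟩ := hN k hk
    exact h
  obtain ⟨m, ho⟩ := exists_config_blocks_at n 0 0
  obtain ⟨y, hy, h0, -⟩ := ho m le_rfl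
  have hxa : x.1 (n, 0, a) := by
    have := hn ⟨_, hy.shift (-a)⟩ (by simpa using h0)
    rw [mem_singleton_iff] at this
    rw [← this]
    simpa using h0
  have h1 := hxa
  rw [← hfix N le_rfl, configShift_iterate_apply] at h1
  have h2 := hxa
  rw [← hfix (N + 1) (by omega), configShift_iterate_apply] at h2
  have := x.2.eq_of_overlap h1 h2 (q := a + N + 1) (by omega)
    (by linarith [eight_le_blockLen n]) (by push_cast; omega)
    (by push_cast; linarith [blockLen_pos n])
  push_cast at this
  omega

theorem nonempty_configSpace_homeomorph_cantorSet : Nonempty (ConfigSpace ≃ₜ cantorSet) := by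
  have : Nonempty ConfigSpace := ⟨emptyConfig⟩
  obtain ⟨f⟩ := nonempty_homeomorph_nat_to_bool
    (c := fun n (x : ConfigSpace) => x.1 ((Denumerable.eqv (ℕ × ℕ × ℤ)).symm n))
    (fun n => continuous_config_apply _)
    (fun x y h => Subtype.ext (funext fun c => by
      simpa using h (Denumerable.eqv (ℕ × ℕ × ℤ) c)))
    not_isOpen_singleton_config
  exact ⟨f.trans cantorSetHomeomorphNatToBool.symm⟩

/-! ### Transfer to the Cantor set -/

section Conjugation

variable {X Y : Type*}

theorem iterate_conj [TopologicalSpace X] [TopologicalSpace Y] (h : X ≃ₜ Y) (T : X ≃ₜ X)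
    (k : ℕ) (x : X) :
    (h.symm.trans (T.trans h))^[k] (h x) = h (T^[k] x) :=
  ((Function.Semiconj.iterate_right (f := h) (ga := T) (gb := h.symm.trans (T.trans h))
    (fun x => by simp) k) x).symm

theorem IsTopologicallyMixing.conj [TopologicalSpace X] [TopologicalSpace Y] (h : X ≃ₜ Y)
    {T : X ≃ₜ X} (hT : IsTopologicallyMixing T) :
    IsTopologicallyMixing (h.symm.trans (T.trans h)) := by
  intro U V hU hV hUne hVne
  obtain ⟨N, hN⟩ := hT (h ⁻¹' U) (h ⁻¹' V) (hU.preimage h.continuous) (hV.preimage h.continuous)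
    (hUne.preimage h.surjective) (hVne.preimage h.surjective)
  refine ⟨N, fun n hn => ?_⟩
  obtain ⟨_, ⟨x, hx, rfl⟩, hxV⟩ := hN n hn
  exact ⟨_, ⟨h x, hx, rfl⟩, by rw [iterate_conj]; exact hxV⟩

variable [MetricSpace Y] [CompactSpace Y]

theorem isBounded_dist_orbit (T : Y → Y) (x y : Y) :
    ∃ C, ∀ n : ℕ, dist (T^[n] x) (T^[n] y) ≤ C :=
  ⟨_, fun _ => Metric.dist_le_diam_of_mem isCompact_univ.isBounded (mem_univ _) (mem_univ _)⟩

theorem isProximalPair_of_frequently {T : Y → Y} {x y : Y}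
    (H : ∀ ε > 0, ∃ᶠ n in atTop, dist (T^[n] x) (T^[n] y) ≤ ε) : IsProximalPair T x y := by
  obtain ⟨C, hC⟩ := isBounded_dist_orbit T x y
  refine le_antisymm (le_of_forall_pos_le_add fun ε hε => ?_) ?_
  · rw [zero_add]
    exact liminf_le_of_frequently_le (H ε hε)
      ⟨0, eventually_map.2 (.of_forall fun _ => dist_nonneg)⟩
  · exact le_liminf_of_le (isCoboundedUnder_ge_of_le _ hC) (.of_forall fun _ => dist_nonneg)

theorem eventually_dist_lt_of_isAsymptoticPair {T : Y → Y} {x y : Y} (H : IsAsymptoticPair T x y)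
    {ε : ℝ} (hε : 0 < ε) : ∀ᶠ n in atTop, dist (T^[n] x) (T^[n] y) < ε := by
  obtain ⟨C, hC⟩ := isBounded_dist_orbit T x y
  exact eventually_lt_of_limsup_lt (H.trans_lt hε) (isBoundedUnder_of ⟨C, hC⟩)

theorem eventually_eq_of_isAsymptoticPair {T : Y → Y} {x y : Y} (H : IsAsymptoticPair T x y)
    {f : Y → Bool} (hf : Continuous f) : ∀ᶠ n in atTop, f (T^[n] x) = f (T^[n] y) := by
  have hg : Continuous fun z => if f z then (1 : ℝ) else 0 :=
    (continuous_of_discreteTopology (f := fun b : Bool => if b then (1 : ℝ) else 0)).comp hf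
  obtain ⟨δ, hδ, hd⟩ := Metric.uniformContinuous_iff.1
    (CompactSpace.uniformContinuous_of_continuous hg) 1 one_pos
  filter_upwards [eventually_dist_lt_of_isAsymptoticPair H hδ] with n hn
  have := hd hn
  revert this
  cases f (T^[n] x) <;> cases f (T^[n] y) <;> simp

end Conjugation

theorem isCompletelyScrambled_conj_configShift {Y : Type*} [MetricSpace Y] [CompactSpace Y]
    (h : ConfigSpace ≃ₜ Y) :
    IsCompletelyScrambled (h.symm.trans (configShift.trans h)) := by
  intro x' _ y' _ hxy
  obtain ⟨x, rfl⟩ := h.surjective x'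
  obtain ⟨y, rfl⟩ := h.surjective y'
  have hne : x.1 ≠ y.1 := fun hc => hxy (congrArg h (Subtype.ext hc))
  constructor
  · refine isProximalPair_of_frequently fun ε hε => frequently_atTop.2 fun k₀ => ?_
    obtain ⟨N, hN⟩ := ConfigSpace.exists_window
      ((Metric.isOpen_ball (x := h emptyConfig) (ε := ε / 2)).preimage h.continuous)
      (Metric.mem_ball_self (half_pos hε))
    obtain ⟨t, ht, H⟩ := x.2.exists_common_gap y.2 hne N k₀
    lift t to ℕ using by omega
    refine ⟨t, by omega, ?_⟩
    have hx : configShift^[t] x ∈ h ⁻¹' Metric.ball (h emptyConfig) (ε / 2) :=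
      hN _ fun m hm k q hq => by
        rw [configShift_iterate_apply]
        exact Bool.eq_false_of_not_eq_true (H m hm k q hq).1
    have hy : configShift^[t] y ∈ h ⁻¹' Metric.ball (h emptyConfig) (ε / 2) :=
      hN _ fun m hm k q hq => by
        rw [configShift_iterate_apply]
        exact Bool.eq_false_of_not_eq_true (H m hm k q hq).2
    rw [iterate_conj, iterate_conj]
    linarith [dist_triangle_right (h (configShift^[t] x)) (h (configShift^[t] y))
      (h emptyConfig), Metric.mem_ball.1 hx, Metric.mem_ball.1 hy]
  · refine fun H => hne (x.2.eq_of_eventually_eq y.2 fun k => ?_)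
    obtain ⟨t₀, ht₀⟩ := eventually_atTop.1 (eventually_eq_of_isAsymptoticPair H
      ((continuous_config_apply (0, k, 0)).comp h.symm.continuous))
    refine ⟨t₀, fun t ht => ?_⟩
    lift t to ℕ using by omega
    have := ht₀ t (by omega)
    rw [iterate_conj, iterate_conj] at this
    simpa [configShift_iterate_apply] using this

theorem theorem1p2 :
    ∃ T : cantorSet ≃ₜ cantorSet,
      IsTopologicallyMixing T ∧ IsCompletelyScrambled T ∧
        ∃ (𝒢 : BDCoverSeq) (h : 𝒢.Limit ≃ₜ cantorSet),
          ∀ x y : 𝒢.Limit, 𝒢.LimitRel x y ↔ T (h x) = h y := by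
  obtain ⟨h⟩ := nonempty_configSpace_homeomorph_cantorSet
  exact ⟨h.symm.trans (configShift.trans h), isTopologicallyMixing_configShift.conj h,
    isCompletelyScrambled_conj_configShift h,
    exists_bdCoverSeq_homeomorph _ cantorSetHomeomorphNatToBool.continuous
      cantorSetHomeomorphNatToBool.injective⟩
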